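/- Let $k$ be an algebraically closed field of characteristic zero and let $H$ be a Hopf algebra over $k$ with antipode $S$ (Sweedler notation $\Delta(h)=h_1\otimes h_2$). Let $A$ and $L$ be Hopf subalgebras of $H$ that are semisimple as rings, with $A\cap L=k1$, and suppose that $A$ is normal in $H$, i.e. $h_1 a S(h_2)\in A$ and $S(h_1)\,a\,h_2\in A$ for all $h\in H$, $a\in A$. Let $A\#L$ be the smash product for the adjoint action $l.a=l_1aS(l_2)$ of $L$ on $A$: the vector space $A\otimes L$ (with $a\#l$ denoting $a\otimes l$), with multiplication $(a\#l)(b\#h)=a(l_1.b)\#l_2h$, unit $1\#1$, the tensor product coalgebra structure, and the linear map $\widetilde S(a\#l)=(1\#S(l))(S(a)\#1)$. Then the span $AL$ of all products $al$ $(a\in A,\ l\in L)$ is a Hopf subalgebra of $H$, $A\#L$ with these structures is a Hopf algebra with antipode $\widetilde S$, and the multiplication map $\phi:A\#L\to AL$, $a\#l\mapsto al$, is an isomorphism of Hopf algebras. -/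

import Mathlib

open scoped TensorProduct

noncomputable section

/-! ### Transport of structure along an injective map -/

section OfInjective

/-- If `f : V → C` is an injective linear map into a coalgebra and `D : V → V ⊗ V` lifts the
comultiplication of `C`, then `V` is a coalgebra with comultiplication `D` and counit `ε ∘ f`. -/
abbrev coalgebraOfInjective {k V C : Type*} [Field k] [AddCommGroup V] [Module k V]
    [AddCommGroup C] [Module k C] [Coalgebra k C] (f : V →ₗ[k] C) (hf : Function.Injective f)
    (D : V →ₗ[k] V ⊗[k] V)
    (hD : ∀ x, TensorProduct.map f f (D x) = Coalgebra.comul (R := k) (f x)) :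
    Coalgebra k V where
  comul := D
  counit := Coalgebra.counit ∘ₗ f
  coassoc := by
    ext x
    apply TensorProduct.map_injective_of_flat_flat f (TensorProduct.map f f) hf
      (TensorProduct.map_injective_of_flat_flat f f hf hf)
    have h0 : ∀ (u : V ⊗[k] V) (b : V), TensorProduct.map f (TensorProduct.map f f)
        (TensorProduct.assoc k V V V (u ⊗ₜ[k] b)) =
        TensorProduct.assoc k C C C (TensorProduct.map f f u ⊗ₜ[k] f b) := by
      intro u b
      induction u with
      | zero => simp
      | add p q hp hq => simp only [map_add, TensorProduct.add_tmul, hp, hq]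
      | tmul p q => simp
    have h1 : ∀ t : V ⊗[k] V, TensorProduct.map f (TensorProduct.map f f)
        (TensorProduct.assoc k V V V (D.rTensor V t)) =
        TensorProduct.assoc k C C C ((Coalgebra.comul (R := k)).rTensor C
          (TensorProduct.map f f t)) := by
      intro t
      induction t with
      | zero => simp
      | add a b ha hb => simp only [map_add, ha, hb]
      | tmul a b => simp [h0, hD]
    have h2 : ∀ t : V ⊗[k] V, TensorProduct.map f (TensorProduct.map f f) (D.lTensor V t) =
        (Coalgebra.comul (R := k)).lTensor C (TensorProduct.map f f t) := by
      intro t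
      induction t with
      | zero => simp
      | add a b ha hb => simp only [map_add, ha, hb]
      | tmul a b => simp [hD]
    simp only [LinearMap.comp_apply, LinearEquiv.coe_coe]
    rw [h1, h2, hD, Coalgebra.coassoc_apply]
  rTensor_counit_comp_comul := by
    ext x
    apply TensorProduct.map_injective_of_flat_flat (LinearMap.id : k →ₗ[k] k) f
      Function.injective_id hf
    have h : ∀ t : V ⊗[k] V, TensorProduct.map (LinearMap.id : k →ₗ[k] k) f
        ((Coalgebra.counit ∘ₗ f).rTensor V t) =
        (Coalgebra.counit (R := k)).rTensor C (TensorProduct.map f f t) := by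
      intro t
      induction t with
      | zero => simp
      | add a b ha hb => simp only [map_add, ha, hb]
      | tmul a b => simp
    rw [LinearMap.comp_apply, h, hD]
    simp
  lTensor_counit_comp_comul := by
    ext x
    apply TensorProduct.map_injective_of_flat_flat f (LinearMap.id : k →ₗ[k] k)
      hf Function.injective_id
    have h : ∀ t : V ⊗[k] V, TensorProduct.map f (LinearMap.id : k →ₗ[k] k)
        ((Coalgebra.counit ∘ₗ f).lTensor V t) =
        (Coalgebra.counit (R := k)).lTensor C (TensorProduct.map f f t) := by
      intro t
      induction t with
      | zero => simp
      | add a b ha hb => simp only [map_add, ha, hb]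
      | tmul a b => simp
    rw [LinearMap.comp_apply, h, hD]
    simp

/-- If `f : B → H` is an injective algebra map into a Hopf algebra, and `D : B → B ⊗ B` and
`S : B → B` lift the comultiplication and the antipode of `H`, then `B` is a Hopf algebra. -/
abbrev hopfAlgebraOfInjective {k B H : Type*} [Field k] [Ring B] [Algebra k B]
    [Ring H] [HopfAlgebra k H] (f : B →ₐ[k] H) (hf : Function.Injective f)
    (D : B →ₗ[k] B ⊗[k] B)
    (hD : ∀ x, TensorProduct.map f.toLinearMap f.toLinearMap (D x) =
      Coalgebra.comul (R := k) (f x))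
    (S : B →ₗ[k] B) (hS : ∀ x, f (S x) = HopfAlgebra.antipode k (f x)) :
    HopfAlgebra k B where
  toBialgebra :=
    letI : Coalgebra k B := coalgebraOfInjective f.toLinearMap hf D hD
    Bialgebra.mk' k B
      (by change Coalgebra.counit (R := k) (f 1) = 1; simp)
      (by intro a b
          change Coalgebra.counit (R := k) (f (a * b)) =
            Coalgebra.counit (R := k) (f a) * Coalgebra.counit (R := k) (f b)
          simp)
      (by apply TensorProduct.map_injective_of_flat_flat f.toLinearMap f.toLinearMap hf hf
          change TensorProduct.map f.toLinearMap f.toLinearMap (D 1) = _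
          rw [hD]
          simp [Algebra.TensorProduct.one_def])
      (by intro a b
          apply TensorProduct.map_injective_of_flat_flat f.toLinearMap f.toLinearMap hf hf
          change TensorProduct.map f.toLinearMap f.toLinearMap (D (a * b)) =
            Algebra.TensorProduct.map f f (D a * D b)
          rw [hD, map_mul, Bialgebra.comul_mul, ← hD, ← hD]
          exact (map_mul (Algebra.TensorProduct.map f f) _ _).symm)
  antipode := S
  mul_antipode_rTensor_comul := by
    ext x
    apply hf
    have h : ∀ t : B ⊗[k] B, f (LinearMap.mul' k B (S.rTensor B t)) =
        LinearMap.mul' k H ((HopfAlgebra.antipode k).rTensor H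
          (TensorProduct.map f.toLinearMap f.toLinearMap t)) := by
      intro t
      induction t with
      | zero => simp
      | add a b ha hb => simp only [map_add, ha, hb]
      | tmul a b => simp [hS]
    change f (LinearMap.mul' k B (S.rTensor B (D x))) =
      f (algebraMap k B (Coalgebra.counit (R := k) (f x)))
    rw [h, hD, HopfAlgebra.mul_antipode_rTensor_comul_apply, AlgHom.commutes]
  mul_antipode_lTensor_comul := by
    ext x
    apply hf
    have h : ∀ t : B ⊗[k] B, f (LinearMap.mul' k B (S.lTensor B t)) =
        LinearMap.mul' k H ((HopfAlgebra.antipode k).lTensor H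
          (TensorProduct.map f.toLinearMap f.toLinearMap t)) := by
      intro t
      induction t with
      | zero => simp
      | add a b ha hb => simp only [map_add, ha, hb]
      | tmul a b => simp [hS]
    change f (LinearMap.mul' k B (S.lTensor B (D x))) =
      f (algebraMap k B (Coalgebra.counit (R := k) (f x)))
    rw [h, hD, HopfAlgebra.mul_antipode_lTensor_comul_apply, AlgHom.commutes]

end OfInjective

/-! ### Hopf subalgebras -/

/-- A Hopf subalgebra `A` of a Hopf algebra `H`: a subalgebra with `Δ(A) ⊆ A ⊗ A`
(that is, `Δ(A)` lies in the image of `A ⊗ A` in `H ⊗ H`) and `S(A) ⊆ A`. -/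
structure HopfSubalgebra (k H : Type*) [Field k] [Ring H] [HopfAlgebra k H]
    extends Subalgebra k H where
  comul_mem' : ∀ x ∈ toSubalgebra, Coalgebra.comul (R := k) x ∈
    LinearMap.range (TensorProduct.map toSubalgebra.val.toLinearMap toSubalgebra.val.toLinearMap)
  antipode_mem' : ∀ x ∈ toSubalgebra, HopfAlgebra.antipode k x ∈ toSubalgebra

namespace HopfSubalgebra

variable {k H : Type*} [Field k] [Ring H] [HopfAlgebra k H] (A : HopfSubalgebra k H)

/-- The inclusion `A → H`. -/
def incl : A.toSubalgebra →ₗ[k] H := A.toSubalgebra.val.toLinearMap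

@[simp] theorem incl_apply (x : A.toSubalgebra) : A.incl x = (x : H) := rfl

theorem incl_injective : Function.Injective A.incl := Subtype.val_injective

theorem map_incl_injective : Function.Injective (TensorProduct.map A.incl A.incl) :=
  TensorProduct.map_injective_of_flat_flat _ _ A.incl_injective A.incl_injective

/-- The comultiplication of `H` restricted to `A`, as a map `A → A ⊗ A`. -/
def comulMap : A.toSubalgebra →ₗ[k] A.toSubalgebra ⊗[k] A.toSubalgebra :=
  (LinearEquiv.ofInjective (TensorProduct.map A.incl A.incl) A.map_incl_injective).symm.toLinearMap
    ∘ₗ (Coalgebra.comul ∘ₗ A.incl).codRestrict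
      (LinearMap.range (TensorProduct.map A.incl A.incl)) (fun x => A.comul_mem' x x.2)

theorem map_incl_comulMap (x : A.toSubalgebra) :
    TensorProduct.map A.incl A.incl (A.comulMap x) = Coalgebra.comul (R := k) (x : H) := by
  have := (LinearEquiv.ofInjective (TensorProduct.map A.incl A.incl)
    A.map_incl_injective).apply_symm_apply
      ((Coalgebra.comul ∘ₗ A.incl).codRestrict
      (LinearMap.range (TensorProduct.map A.incl A.incl)) (fun x => A.comul_mem' x x.2) x)
  exact congrArg Subtype.val this

/-- The antipode of `H` restricted to `A`. -/
def antipodeMap : A.toSubalgebra →ₗ[k] A.toSubalgebra :=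
  (HopfAlgebra.antipode k ∘ₗ A.incl).codRestrict (Subalgebra.toSubmodule A.toSubalgebra)
    (fun x => A.antipode_mem' x x.2)

@[simp] theorem coe_antipodeMap (x : A.toSubalgebra) :
    (A.antipodeMap x : H) = HopfAlgebra.antipode k (x : H) := rfl

/-- A Hopf subalgebra is a Hopf algebra under the operations restricted from `H`. -/
instance instHopfAlgebra : HopfAlgebra k A.toSubalgebra :=
  hopfAlgebraOfInjective A.toSubalgebra.val A.incl_injective A.comulMap A.map_incl_comulMap
    A.antipodeMap (fun _ => rfl)

theorem map_incl_comul (x : A.toSubalgebra) :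
    TensorProduct.map A.incl A.incl (Coalgebra.comul (R := k) x) =
      Coalgebra.comul (R := k) (x : H) := A.map_incl_comulMap x

theorem counit_coe (x : A.toSubalgebra) :
    Coalgebra.counit (R := k) x = Coalgebra.counit (R := k) (x : H) := rfl

theorem coe_antipode (x : A.toSubalgebra) :
    (HopfAlgebra.antipode k x : H) = HopfAlgebra.antipode k (x : H) := rfl

end HopfSubalgebra

/-! ### Adjoint actions and normality -/

/-- The left adjoint action `x ↦ h₁ x S(h₂)` of a Hopf algebra on itself. -/
def leftAdjoint (k : Type*) {H : Type*} [Field k] [Ring H] [HopfAlgebra k H] :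
    H →ₗ[k] Module.End k H :=
  TensorProduct.lift ((LinearMap.mul k (Module.End k H)).compl₁₂ (LinearMap.mul k H)
    ((LinearMap.mul k H).flip ∘ₗ HopfAlgebra.antipode k)) ∘ₗ Coalgebra.comul

/-- The right adjoint action `x ↦ S(h₁) x h₂` of a Hopf algebra on itself. -/
def rightAdjoint (k : Type*) {H : Type*} [Field k] [Ring H] [HopfAlgebra k H] :
    H →ₗ[k] Module.End k H :=
  TensorProduct.lift ((LinearMap.mul k (Module.End k H)).compl₁₂
    (LinearMap.mul k H ∘ₗ HopfAlgebra.antipode k) (LinearMap.mul k H).flip) ∘ₗ Coalgebra.comul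

section Adjoint

variable {k H : Type*} [Field k] [Ring H] [HopfAlgebra k H]

theorem leftAdjoint_apply {ι : Type*} {h : H} (r : Coalgebra.Repr k h ι) (x : H) :
    leftAdjoint k h x = ∑ i ∈ r.index, r.left i * x * HopfAlgebra.antipode k (r.right i) := by
  simp [leftAdjoint, ← r.eq, LinearMap.sum_apply, mul_assoc]

theorem rightAdjoint_apply {ι : Type*} {h : H} (r : Coalgebra.Repr k h ι) (x : H) :
    rightAdjoint k h x = ∑ i ∈ r.index, HopfAlgebra.antipode k (r.left i) * x * r.right i := by
  simp [rightAdjoint, ← r.eq, LinearMap.sum_apply, mul_assoc]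

theorem leftAdjoint_one : leftAdjoint k (1 : H) = 1 := by
  ext x
  simp [leftAdjoint, Algebra.TensorProduct.one_def]

theorem leftAdjoint_mul (g h : H) : leftAdjoint k (g * h) = leftAdjoint k g * leftAdjoint k h := by
  ext x
  let rg := Coalgebra.Repr.arbitrary k g
  let rh := Coalgebra.Repr.arbitrary k h
  rw [Module.End.mul_apply, leftAdjoint_apply (rg.mul rh), leftAdjoint_apply rh,
    leftAdjoint_apply rg]
  simp only [Coalgebra.Repr.mul_index, Coalgebra.Repr.mul_left, Coalgebra.Repr.mul_right,
    Finset.sum_product, Finset.mul_sum, Finset.sum_mul, HopfAlgebra.antipode_mul_antidistrib,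
    mul_assoc]

theorem leftAdjoint_apply_one (h : H) :
    leftAdjoint k h 1 = Coalgebra.counit (R := k) h • (1 : H) := by
  rw [leftAdjoint_apply (Coalgebra.Repr.arbitrary k h)]
  simpa using HopfAlgebra.sum_mul_antipode_eq_smul (Coalgebra.Repr.arbitrary k h)

theorem sum_mul_mul_eq {ι : Type*} {l : H} (r : Coalgebra.Repr k l ι) (f g h : H →ₗ[k] H) :
    ∑ i ∈ r.index, ∑ j ∈ (Coalgebra.Repr.arbitrary k (r.right i)).index,
      f (r.left i) * (g ((Coalgebra.Repr.arbitrary k (r.right i)).left j) *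
        h ((Coalgebra.Repr.arbitrary k (r.right i)).right j)) =
    ∑ i ∈ r.index, ∑ j ∈ (Coalgebra.Repr.arbitrary k (r.left i)).index,
      f ((Coalgebra.Repr.arbitrary k (r.left i)).left j) *
        (g ((Coalgebra.Repr.arbitrary k (r.left i)).right j) * h (r.right i)) := by
  have := congrArg (LinearMap.mul' k H ∘ₗ (LinearMap.mul' k H).lTensor H)
    (Coalgebra.sum_map_tmul_tmul_eq f g h l (repr := r)
      (a₁ := fun i => Coalgebra.Repr.arbitrary k (r.left i))
      (a₂ := fun i => Coalgebra.Repr.arbitrary k (r.right i)))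
  simpa only [map_sum, LinearMap.comp_apply, LinearMap.lTensor_tmul, LinearMap.mul'_apply]
    using this

theorem sum_leftAdjoint_mul {ι : Type*} {l : H} (r : Coalgebra.Repr k l ι) (x : H) :
    ∑ i ∈ r.index, leftAdjoint k (r.left i) x * r.right i = l * x := by
  have h := sum_mul_mul_eq r (LinearMap.mulRight k x) (HopfAlgebra.antipode k) LinearMap.id
  simp only [LinearMap.mulRight_apply, LinearMap.id_apply, ← Finset.mul_sum,
    HopfAlgebra.sum_antipode_mul_eq_smul, mul_smul_comm, mul_one] at h
  simp only [leftAdjoint_apply (Coalgebra.Repr.arbitrary k (r.left _)), Finset.sum_mul]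
  simp only [← mul_assoc] at h
  rw [← h]
  have h' := congrArg (TensorProduct.lift (LinearMap.lsmul k H).flip)
    (Coalgebra.sum_tmul_counit_eq r)
  simp only [map_sum, TensorProduct.lift.tmul, LinearMap.flip_apply] at h'
  have h'' : ∑ i ∈ r.index, Coalgebra.counit (R := k) (r.right i) • r.left i = l := by
    simpa using h'
  calc _ = (∑ i ∈ r.index, Coalgebra.counit (R := k) (r.right i) • r.left i) * x := by
        simp [Finset.sum_mul]
    _ = l * x := by rw [h'']

theorem leftAdjoint_apply_mul {ι : Type*} {l : H} (r : Coalgebra.Repr k l ι) (x y : H) :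
    leftAdjoint k l (x * y) =
      ∑ i ∈ r.index, leftAdjoint k (r.left i) x * leftAdjoint k (r.right i) y := by
  have h := sum_mul_mul_eq r ((leftAdjoint k).flip x) (LinearMap.mulRight k y)
    (HopfAlgebra.antipode k)
  simp only [LinearMap.mulRight_apply, LinearMap.flip_apply, ← Finset.mul_sum,
    ← leftAdjoint_apply] at h
  rw [h, leftAdjoint_apply r]
  refine Finset.sum_congr rfl fun i _ => ?_
  simp only [← mul_assoc, ← Finset.sum_mul]
  rw [sum_leftAdjoint_mul]

end Adjoint

namespace HopfSubalgebra

variable {k H : Type*} [Field k] [Ring H] [HopfAlgebra k H]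

/-- `A` is normal in `H`: `h₁ A S(h₂) ⊆ A` and `S(h₁) A h₂ ⊆ A` for all `h : H`. -/
def IsNormal (A : HopfSubalgebra k H) : Prop :=
  ∀ h : H, ∀ a ∈ A.toSubalgebra,
    leftAdjoint k h a ∈ A.toSubalgebra ∧ rightAdjoint k h a ∈ A.toSubalgebra

end HopfSubalgebra

/-! ### Module algebras and smash products -/

/-- The structure of a left `L`-module algebra on `A`: an action of `L` on `A` with
`l.1 = ε(l) 1` and `l.(a b) = (l₁.a) (l₂.b)`. -/
structure ModuleAlgebra (k L A : Type*) [Field k] [Ring L] [Bialgebra k L] [Ring A]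
    [Algebra k A] where
  act : L →ₐ[k] Module.End k A
  act_one : ∀ l, act l 1 = Coalgebra.counit (R := k) l • (1 : A)
  act_mul : ∀ l a b, act l (a * b) =
    LinearMap.mul' k A (TensorProduct.map (act.toLinearMap.flip a) (act.toLinearMap.flip b)
      (Coalgebra.comul (R := k) l))

namespace ModuleAlgebra

variable {k L A : Type*} [Field k] [Ring L] [Bialgebra k L] [Ring A] [Algebra k A]
  (M : ModuleAlgebra k L A)

theorem act_mul_repr {ι : Type*} {l : L} (r : Coalgebra.Repr k l ι) (a b : A) :
    M.act l (a * b) = ∑ i ∈ r.index, M.act (r.left i) a * M.act (r.right i) b := by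
  rw [M.act_mul, ← r.eq]
  simp

/-- The diagonal action of `L` on `A ⊗ L`: `l` sends `b ⊗ h` to `l₁.b ⊗ l₂ h`. -/
def diag : L →ₗ[k] Module.End k (A ⊗[k] L) :=
  TensorProduct.homTensorHomMap (RingHom.id k) A L A L ∘ₗ
    TensorProduct.map M.act.toLinearMap (LinearMap.mul k L) ∘ₗ Coalgebra.comul

theorem diag_tmul {ι : Type*} {l : L} (r : Coalgebra.Repr k l ι) (b : A) (h : L) :
    M.diag l (b ⊗ₜ h) = ∑ i ∈ r.index, M.act (r.left i) b ⊗ₜ[k] (r.right i * h) := by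
  simp [diag, ← r.eq, LinearMap.sum_apply]

theorem diag_one : M.diag 1 = 1 := by
  apply TensorProduct.ext'
  intro b h
  simp [diag, Algebra.TensorProduct.one_def]

theorem diag_mul (l h : L) : M.diag (l * h) = M.diag l * M.diag h := by
  apply TensorProduct.ext'
  intro b g
  let rl := Coalgebra.Repr.arbitrary k l
  let rh := Coalgebra.Repr.arbitrary k h
  rw [Module.End.mul_apply, M.diag_tmul rh, map_sum, M.diag_tmul (rl.mul rh)]
  simp only [M.diag_tmul rl, Coalgebra.Repr.mul_index, Coalgebra.Repr.mul_left,
    Coalgebra.Repr.mul_right, Finset.sum_product, map_mul, Module.End.mul_apply, mul_assoc]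
  rw [Finset.sum_comm]

/-- Left multiplication of `A` on the first factor of `A ⊗ L`. -/
def lmulLeft (_M : ModuleAlgebra k L A) : A →ₗ[k] Module.End k (A ⊗[k] L) :=
  LinearMap.rTensorHom L ∘ₗ LinearMap.mul k A

@[simp] theorem lmulLeft_tmul (a b : A) (h : L) :
    M.lmulLeft a (b ⊗ₜ h) = (a * b) ⊗ₜ[k] h := rfl

theorem lmulLeft_mul (a b : A) : M.lmulLeft (a * b) = M.lmulLeft a * M.lmulLeft b := by
  apply TensorProduct.ext'
  intro c g
  simp [mul_assoc]

theorem diag_mul_lmulLeft {ι : Type*} {l : L} (r : Coalgebra.Repr k l ι) (b : A) :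
    M.diag l * M.lmulLeft b =
      ∑ i ∈ r.index, M.lmulLeft (M.act (r.left i) b) * M.diag (r.right i) := by
  apply TensorProduct.ext'
  intro c g
  let F : L ⊗[k] (L ⊗[k] L) →ₗ[k] A ⊗[k] L :=
    TensorProduct.map (LinearMap.mul' k A) LinearMap.id ∘ₗ
      (TensorProduct.assoc k A A L).symm.toLinearMap ∘ₗ
        TensorProduct.map (M.act.toLinearMap.flip b)
          (TensorProduct.map (M.act.toLinearMap.flip c) (LinearMap.mulRight k g))
  have hF := congrArg F (Coalgebra.sum_tmul_tmul_eq r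
    (fun i => Coalgebra.Repr.arbitrary k (r.left i))
    (fun i => Coalgebra.Repr.arbitrary k (r.right i)))
  simp only [map_sum, F, LinearMap.comp_apply, TensorProduct.map_tmul, LinearMap.flip_apply,
    AlgHom.toLinearMap_apply, LinearEquiv.coe_coe, TensorProduct.assoc_symm_tmul,
    LinearMap.mul'_apply, LinearMap.id_apply, LinearMap.mulRight_apply] at hF
  rw [Module.End.mul_apply, lmulLeft_tmul, M.diag_tmul r, LinearMap.sum_apply]
  simp only [Module.End.mul_apply]
  convert hF using 2 with i _ i _
  · rw [M.act_mul_repr (Coalgebra.Repr.arbitrary k (r.left i)), TensorProduct.sum_tmul]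
  · rw [M.diag_tmul (Coalgebra.Repr.arbitrary k (r.right i)), map_sum]
    simp

end ModuleAlgebra

/-- The smash product `A # L` attached to an action of `L` on `A`: the vector space `A ⊗ L`,
with the operations defined below. -/
def SmashProduct {k L A : Type*} [Field k] [Ring L] [Bialgebra k L] [Ring A] [Algebra k A]
    (_M : ModuleAlgebra k L A) : Type _ := A ⊗[k] L

namespace SmashProduct

section Algebra

variable {k L A : Type*} [Field k] [Ring L] [Bialgebra k L] [Ring A] [Algebra k A]
  (M : ModuleAlgebra k L A)

instance instAddCommGroup : AddCommGroup (SmashProduct M) :=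
  inferInstanceAs (AddCommGroup (A ⊗[k] L))

instance instModule : Module k (SmashProduct M) :=
  inferInstanceAs (Module k (A ⊗[k] L))

/-- The element `a # l` of the smash product, as a bilinear map. -/
def mk : A →ₗ[k] L →ₗ[k] SmashProduct M := TensorProduct.mk k A L

variable {M} in
theorem induction {P : SmashProduct M → Prop} (x : SmashProduct M) (h0 : P 0)
    (hmk : ∀ a l, P (mk M a l)) (hadd : ∀ x y, P x → P y → P (x + y)) : P x :=
  TensorProduct.induction_on (motive := P) x h0 hmk hadd

/-- The multiplication of `A ⊗ L` determined by `(a # l) (b # h) = a (l₁.b) # l₂ h`. -/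
def mulAux : A ⊗[k] L →ₗ[k] Module.End k (A ⊗[k] L) :=
  TensorProduct.lift ((LinearMap.mul k (Module.End k (A ⊗[k] L))).compl₁₂ M.lmulLeft M.diag)

theorem mulAux_tmul (a : A) (l : L) : mulAux M (a ⊗ₜ l) = M.lmulLeft a * M.diag l := rfl

theorem mulAux_mul (x y : A ⊗[k] L) : mulAux M (mulAux M x y) = mulAux M x * mulAux M y := by
  induction x with
  | zero => simp
  | add x x' hx hx' => simp only [map_add, LinearMap.add_apply, hx, hx', add_mul]
  | tmul a l =>
    induction y with
    | zero => simp
    | add y y' hy hy' => simp only [map_add, hy, hy', mul_add]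
    | tmul b h =>
      let r := Coalgebra.Repr.arbitrary k l
      rw [mulAux_tmul, mulAux_tmul, mul_assoc, ← mul_assoc (M.diag l), M.diag_mul_lmulLeft r,
        Module.End.mul_apply, M.diag_tmul r, map_sum, map_sum, Finset.sum_mul, Finset.mul_sum]
      refine Finset.sum_congr rfl fun i _ => ?_
      rw [M.lmulLeft_tmul, mulAux_tmul, M.lmulLeft_mul, M.diag_mul]
      simp only [mul_assoc]

instance instRing : Ring (SmashProduct M) where
  __ := instAddCommGroup M
  mul x y := mulAux M x y
  one := mk M 1 1
  left_distrib x y z := map_add (mulAux M x) y z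
  right_distrib x y z := LinearMap.congr_fun (map_add (mulAux M) x y) z
  zero_mul x := LinearMap.congr_fun (map_zero (mulAux M)) x
  mul_zero x := map_zero (mulAux M x)
  mul_assoc x y z := LinearMap.congr_fun (mulAux_mul M x y) z
  one_mul x := by
    have h : mulAux M (1 ⊗ₜ 1) = 1 := by
      rw [mulAux_tmul, M.diag_one]
      apply TensorProduct.ext'
      intro b g
      simp
    exact LinearMap.congr_fun h x
  mul_one x := by
    have h : (mulAux M).flip (1 ⊗ₜ 1) = LinearMap.id := by
      apply TensorProduct.ext'
      intro a l
      rw [LinearMap.flip_apply, mulAux_tmul, Module.End.mul_apply,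
        M.diag_tmul (Coalgebra.Repr.arbitrary k l)]
      simp only [M.act_one, mul_one, TensorProduct.smul_tmul]
      rw [← TensorProduct.tmul_sum, Coalgebra.sum_counit_smul]
      simp
    exact LinearMap.congr_fun h x

instance instAlgebra : Algebra k (SmashProduct M) :=
  Algebra.ofModule
    (fun c x y => LinearMap.congr_fun (map_smul (mulAux M) c x) y)
    (fun c x y => map_smul (mulAux M x) c y)

theorem one_def : (1 : SmashProduct M) = mk M 1 1 := rfl

/-- The multiplication rule `(a # l) (b # h) = a (l₁.b) # l₂ h`. -/
theorem mk_mul_mk {ι : Type*} {l : L} (r : Coalgebra.Repr k l ι) (a b : A) (h : L) :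
    mk M a l * mk M b h =
      ∑ i ∈ r.index, mk M (a * M.act (r.left i) b) (r.right i * h) := by
  change M.lmulLeft a (M.diag l (b ⊗ₜ h)) = _
  rw [M.diag_tmul r, map_sum]
  rfl

end Algebra

section Hopf

variable {k L A : Type*} [Field k] [Ring L] [HopfAlgebra k L] [Ring A] [HopfAlgebra k A]
  (M : ModuleAlgebra k L A)

/-- The coalgebra structure of the smash product is the one of the tensor product of
coalgebras. -/
instance instCoalgebra : Coalgebra k (SmashProduct M) :=
  inferInstanceAs (Coalgebra k (A ⊗[k] L))

/-- The antipode of the smash product, `S(a # l) = (1 # S(l)) (S(a) # 1)`. -/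
def antipode : SmashProduct M →ₗ[k] SmashProduct M :=
  TensorProduct.lift ((LinearMap.mul k (SmashProduct M)).flip.compl₁₂
    ((mk M).flip 1 ∘ₗ HopfAlgebra.antipode k) (mk M 1 ∘ₗ HopfAlgebra.antipode k))

theorem antipode_mk (a : A) (l : L) : antipode M (mk M a l) =
    mk M 1 (HopfAlgebra.antipode k l) * mk M (HopfAlgebra.antipode k a) 1 := rfl

theorem counit_mk (a : A) (l : L) : Coalgebra.counit (R := k) (mk M a l) =
    Coalgebra.counit (R := k) a * Coalgebra.counit (R := k) l := by
  rw [mul_comm]; rfl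

theorem comul_mk {ι κ : Type*} {a : A} {l : L} (r : Coalgebra.Repr k a ι)
    (s : Coalgebra.Repr k l κ) : Coalgebra.comul (R := k) (mk M a l) =
    ∑ i ∈ r.index, ∑ j ∈ s.index,
      mk M (r.left i) (s.left j) ⊗ₜ[k] mk M (r.right i) (s.right j) := by
  rw [← Finset.sum_product']
  exact (r.tmul s).eq.symm

end Hopf

end SmashProduct

/-- An algebra `B` carrying also a coalgebra structure and a linear endomorphism `S` is a Hopf
algebra with antipode `S`: `Δ` and `ε` are algebra maps and `S` satisfies the antipode axioms. -/
structure IsHopfAlgebra (k : Type*) {B : Type*} [Field k] [Ring B] [Algebra k B] [Coalgebra k B]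
    (S : B →ₗ[k] B) : Prop where
  counit_one : Coalgebra.counit (R := k) (1 : B) = 1
  counit_mul : ∀ x y : B, Coalgebra.counit (R := k) (x * y) =
    Coalgebra.counit (R := k) x * Coalgebra.counit (R := k) y
  comul_one : Coalgebra.comul (R := k) (1 : B) = 1
  comul_mul : ∀ x y : B, Coalgebra.comul (R := k) (x * y) =
    Coalgebra.comul (R := k) x * Coalgebra.comul (R := k) y
  mul_antipode_rTensor_comul :
    LinearMap.mul' k B ∘ₗ S.rTensor B ∘ₗ Coalgebra.comul =
      Algebra.linearMap k B ∘ₗ Coalgebra.counit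
  mul_antipode_lTensor_comul :
    LinearMap.mul' k B ∘ₗ S.lTensor B ∘ₗ Coalgebra.comul =
      Algebra.linearMap k B ∘ₗ Coalgebra.counit

/-- The Hopf algebra, in the bundled sense, attached to these data. -/
abbrev IsHopfAlgebra.toHopfAlgebra {k B : Type*} [Field k] [Ring B] [Algebra k B]
    [Coalgebra k B] {S : B →ₗ[k] B} (h : IsHopfAlgebra k S) : HopfAlgebra k B where
  toBialgebra := Bialgebra.mk' k B h.counit_one (h.counit_mul _ _) h.comul_one (h.comul_mul _ _)
  antipode := S
  mul_antipode_rTensor_comul := h.mul_antipode_rTensor_comul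
  mul_antipode_lTensor_comul := h.mul_antipode_lTensor_comul

/-! ### The adjoint action of a Hopf subalgebra on a normal Hopf subalgebra -/

namespace HopfSubalgebra

variable {k H : Type*} [Field k] [Ring H] [HopfAlgebra k H]

/-- A decomposition of `Δ(l)` in `L ⊗ L`, read in `H ⊗ H`. -/
def reprCoe (L : HopfSubalgebra k H) {ι : Type*} {l : L.toSubalgebra}
    (r : Coalgebra.Repr k l ι) : Coalgebra.Repr k (l : H) ι where
  index := r.index
  left i := r.left i
  right i := r.right i
  eq := by
    rw [← L.map_incl_comul, ← r.eq, map_sum]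
    simp

/-- The adjoint action `l.a = l₁ a S(l₂)` of a Hopf subalgebra `L` on a normal Hopf
subalgebra `A`, as an algebra map `L → End(A)`. -/
def adjointMap (A L : HopfSubalgebra k H) (hA : A.IsNormal) :
    L.toSubalgebra →ₐ[k] Module.End k A.toSubalgebra :=
  AlgHom.ofLinearMap
    { toFun := fun l => (leftAdjoint k (l : H)).restrict
        (p := Subalgebra.toSubmodule A.toSubalgebra) (q := Subalgebra.toSubmodule A.toSubalgebra)
        (fun a ha => (hA l a ha).1)
      map_add' := fun l l' => by ext a; simp
      map_smul' := fun c l => by ext a; simp }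
    (LinearMap.ext fun a => Subtype.ext (LinearMap.congr_fun leftAdjoint_one (a : H)))
    (fun l l' => LinearMap.ext fun a => Subtype.ext
      (LinearMap.congr_fun (leftAdjoint_mul (l : H) (l' : H)) (a : H)))

theorem coe_adjointMap (A L : HopfSubalgebra k H) (hA : A.IsNormal)
    (l : L.toSubalgebra) (a : A.toSubalgebra) :
    (adjointMap A L hA l a : H) = leftAdjoint k (l : H) (a : H) := rfl

theorem adjointMap_mul (A L : HopfSubalgebra k H) (hA : A.IsNormal) {ι : Type*}
    {l : L.toSubalgebra} (r : Coalgebra.Repr k l ι) (a b : A.toSubalgebra) :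
    adjointMap A L hA l (a * b) =
      ∑ i ∈ r.index, adjointMap A L hA (r.left i) a * adjointMap A L hA (r.right i) b := by
  apply A.incl_injective
  rw [map_sum]
  exact leftAdjoint_apply_mul (L.reprCoe r) (a : H) (b : H)

/-- The adjoint action makes the normal Hopf subalgebra `A` an `L`-module algebra. -/
def adjointAction (A L : HopfSubalgebra k H) (hA : A.IsNormal) :
    ModuleAlgebra k L.toSubalgebra A.toSubalgebra where
  act := adjointMap A L hA
  act_one := fun l => Subtype.ext (leftAdjoint_apply_one (l : H))
  act_mul := fun l a b => by
    rw [adjointMap_mul A L hA (Coalgebra.Repr.arbitrary k l),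
      ← (Coalgebra.Repr.arbitrary k l).eq, map_sum, map_sum]
    rfl

/-- `l.a = l₁ a S(l₂)` in `H`. -/
theorem coe_adjointAction_act (A L : HopfSubalgebra k H) (hA : A.IsNormal)
    (l : L.toSubalgebra) (a : A.toSubalgebra) :
    ((adjointAction A L hA).act l a : H) = leftAdjoint k (l : H) (a : H) := rfl

end HopfSubalgebra

end

/-! Multiplication `A # L → H` respects products because `l b = (l₁.b) l₂`, and respects `Δ`, `ε`
and the antipode by direct computation. Everything therefore reduces to its injectivity
(`smashMul_injective`); the Hopf structure of `A # L` is then pulled back from `H`.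

Semisimplicity enters through normalized integrals `e` of `A` and `f` of `L` (`exists_integral`).
Normality makes `e` central in `H` (`commute_integral`), so `e f` is a normalized left integral of
`A L`. Such an integral forces finite dimension, a bijective antipode and a dual integral `q` with
`q(b₁) b₂ = q(b) 1` (`slice_comul_eq_smul_one`).

The heart is that `l ↦ e l` is injective on `L` (`eq_zero_of_integral_mul_eq_zero`). For `m = q(e
·)` and `g` in `L`, the element `m(g₁) g₂` is coinvariant modulo `e`, hence lies in `A`
(`mem_of_coinvariant`). It also lies in `L`, so it is a scalar. Thus `m` is a dual integral on `L`
with `m(f) = 1`, and it is nondegenerate; `e l = 0` gives `m(l ·) = 0`, hence `l = 0`.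

Finally `a ⊗ l` is recovered from `a l`: `(1 ⊗ e) Δ(a l) = a l₁ ⊗ e l₂`, then `e` is cancelled in
the second factor and `a l₁ S(l₂) ⊗ l₃ = a ⊗ l`. -/

noncomputable section

/-! ### Left integrals in Hopf algebras -/

namespace HopfAlgebra

variable {k B : Type*} [Field k] [Ring B] [HopfAlgebra k B]

/-- Evaluation of a functional on the first tensor factor: `x ⊗ y ↦ q(x) y`. -/
def slice (q : Module.Dual k B) : B ⊗[k] B →ₗ[k] B :=
  (TensorProduct.lid k B).toLinearMap ∘ₗ LinearMap.rTensor B q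

@[simp] theorem slice_tmul (q : Module.Dual k B) (x y : B) : slice q (x ⊗ₜ[k] y) = q x • y := by
  simp [slice]

theorem slice_repr (q : Module.Dual k B) {ι : Type*} {b : B} (r : Coalgebra.Repr k b ι) :
    slice q (Coalgebra.comul (R := k) b) = ∑ i ∈ r.index, q (r.left i) • r.right i := by
  simp [← r.eq]

theorem slice_one_tmul_mul (q : Module.Dual k B) (c : B) (X : B ⊗[k] B) :
    slice q ((1 ⊗ₜ[k] c) * X) = c * slice q X := by
  induction X with
  | zero => simp
  | add x y hx hy => simp only [mul_add, map_add, hx, hy]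
  | tmul x y => simp

theorem slice_tmul_one_mul (q : Module.Dual k B) (c : B) (X : B ⊗[k] B) :
    slice q ((c ⊗ₜ[k] 1) * X) = slice (q ∘ₗ LinearMap.mulLeft k c) X := by
  induction X with
  | zero => simp
  | add x y hx hy => simp only [mul_add, map_add, hx, hy]
  | tmul x y => simp

/-- Coassociativity: both sides are `q(b₁) b₂ ⊗ b₃`. -/
theorem comul_slice_comul (q : Module.Dual k B) (b : B) :
    Coalgebra.comul (R := k) (slice q (Coalgebra.comul (R := k) b)) =
      (slice q ∘ₗ Coalgebra.comul).rTensor B (Coalgebra.comul (R := k) b) := by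
  let r := Coalgebra.Repr.arbitrary k b
  have h := congrArg ((TensorProduct.lid k (B ⊗[k] B)).toLinearMap ∘ₗ LinearMap.rTensor _ q)
    (Coalgebra.sum_tmul_tmul_eq r (fun i => Coalgebra.Repr.arbitrary k (r.left i))
    (fun i => Coalgebra.Repr.arbitrary k (r.right i)))
  simp only [map_sum, LinearMap.comp_apply, LinearMap.rTensor_tmul, LinearEquiv.coe_coe,
    TensorProduct.lid_tmul] at h
  rw [slice_repr q r, map_sum, ← r.eq, map_sum]
  simp only [LinearMap.rTensor_tmul, LinearMap.comp_apply,
    slice_repr q (Coalgebra.Repr.arbitrary k (r.left _)), TensorProduct.sum_tmul,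
    ← TensorProduct.smul_tmul', h, map_smul]
  refine Finset.sum_congr rfl fun i _ => ?_
  conv_lhs => rw [← (Coalgebra.Repr.arbitrary k (r.right i)).eq, Finset.smul_sum]

theorem sum_antipode_tmul_one_mul_comul {ι : Type*} {c : B} (r : Coalgebra.Repr k c ι) :
    ∑ i ∈ r.index, (antipode k (r.left i) ⊗ₜ[k] (1 : B)) * Coalgebra.comul (R := k) (r.right i) =
      1 ⊗ₜ[k] c := by
  have h := congrArg ((LinearMap.mul' k B ∘ₗ (antipode k).rTensor B).rTensor B ∘ₗ
      (TensorProduct.assoc k B B B).symm.toLinearMap)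
    (Coalgebra.sum_tmul_tmul_eq r (fun i => Coalgebra.Repr.arbitrary k (r.left i))
    (fun i => Coalgebra.Repr.arbitrary k (r.right i)))
  simp only [map_sum, LinearMap.comp_apply, LinearMap.rTensor_tmul, LinearEquiv.coe_coe,
    TensorProduct.assoc_symm_tmul, LinearMap.mul'_apply, ← TensorProduct.sum_tmul,
    sum_antipode_mul_eq_smul, TensorProduct.smul_tmul] at h
  rw [← TensorProduct.tmul_sum, Coalgebra.sum_counit_smul] at h
  rw [h]
  refine Finset.sum_congr rfl fun i _ => ?_
  conv_lhs => rw [← (Coalgebra.Repr.arbitrary k (r.right i)).eq, Finset.mul_sum]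
  simp

/-- `Σ c₁ u ⊗ S(c₂ v) c₃ = c u ⊗ S(v)`. -/
theorem sum_lTensor_antipode_comul_mul {ι : Type*} {c : B} (r : Coalgebra.Repr k c ι)
    (X : B ⊗[k] B) :
    ∑ i ∈ r.index, (antipode k).lTensor B (Coalgebra.comul (R := k) (r.left i) * X) *
      (1 ⊗ₜ[k] r.right i) = (c ⊗ₜ[k] 1) * (antipode k).lTensor B X := by
  induction X with
  | zero => simp
  | add x y hx hy => simp only [mul_add, map_add, add_mul, Finset.sum_add_distrib, hx, hy]
  | tmul u v =>
    have h := congrArg (TensorProduct.map (LinearMap.mulRight k u)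
        (LinearMap.mulLeft k (antipode k v) ∘ₗ LinearMap.mul' k B ∘ₗ (antipode k).rTensor B))
      (Coalgebra.sum_tmul_tmul_eq r (fun i => Coalgebra.Repr.arbitrary k (r.left i))
      (fun i => Coalgebra.Repr.arbitrary k (r.right i)))
    simp only [map_sum, LinearMap.comp_apply, LinearMap.rTensor_tmul, TensorProduct.map_tmul,
      LinearMap.mul'_apply, LinearMap.mulLeft_apply, LinearMap.mulRight_apply,
      ← TensorProduct.tmul_sum, ← Finset.mul_sum, sum_antipode_mul_eq_smul] at h
    have h' := congrArg (TensorProduct.map (LinearMap.mulRight k u)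
        (LinearMap.toSpanSingleton k B (antipode k v))) (Coalgebra.sum_tmul_counit_eq r)
    simp only [map_sum, TensorProduct.map_tmul, LinearMap.mulRight_apply,
      LinearMap.toSpanSingleton_apply, one_smul] at h'
    simp only [mul_smul_comm, mul_one, h'] at h
    rw [LinearMap.lTensor_tmul, Algebra.TensorProduct.tmul_mul_tmul, one_mul, ← h]
    refine Finset.sum_congr rfl fun i _ => ?_
    conv_lhs => rw [← (Coalgebra.Repr.arbitrary k (r.left i)).eq, Finset.sum_mul, map_sum,
      Finset.sum_mul]
    simp [antipode_mul_antidistrib, mul_assoc]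

/-! ### Consequences of a normalized left integral `t` -/

section Integral

variable {t : B}

/-- Expand `1 ⊗ c` as `S(c₁) c₂ ⊗ c₃`; then `Δ(c₂) Δ(t) = Δ(c₂ t) = ε(c₂) Δ(t)` absorbs the extra
factor. -/
theorem antipode_tmul_one_mul_comul
    (ht : ∀ b, b * t = Coalgebra.counit (R := k) b • t)
    (c : B) :
    (antipode k c ⊗ₜ[k] (1 : B)) * Coalgebra.comul (R := k) t =
      (1 ⊗ₜ[k] c) * Coalgebra.comul (R := k) t := by
  let r := Coalgebra.Repr.arbitrary k c
  have h := congrArg (TensorProduct.rid k B) (Coalgebra.sum_tmul_counit_eq r)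
  simp only [map_sum, TensorProduct.rid_tmul, one_smul] at h
  rw [← sum_antipode_tmul_one_mul_comul r, Finset.sum_mul]
  simp only [mul_assoc, ← Bialgebra.comul_mul, ht, map_smul, mul_smul_comm]
  conv_lhs => rw [← h]
  simp only [map_sum, map_smul, TensorProduct.sum_tmul, Finset.sum_mul,
    ← TensorProduct.smul_tmul', smul_mul_assoc]

theorem exists_slice_comul_eq_one
    (ht : ∀ b, b * t = Coalgebra.counit (R := k) b • t)
    (h1 : Coalgebra.counit (R := k) t = 1) :
    ∃ q : Module.Dual k B, slice q (Coalgebra.comul (R := k) t) = 1 := by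
  classical
  let b := Module.Basis.ofVectorSpace k B
  obtain ⟨c, hc⟩ := TensorProduct.eq_repr_basis_left b (Coalgebra.comul (R := k) t)
  have hcoord : ∀ i, slice (b.coord i) (Coalgebra.comul (R := k) t) = c i := by
    intro i
    rw [← hc, Finsupp.sum, map_sum]
    simp only [slice_tmul, Module.Basis.coord_apply, Module.Basis.repr_self]
    rw [Finset.sum_eq_single i]
    · simp
    · intro j _ hj
      simp [hj]
    · intro hi
      simp [Finsupp.notMem_support_iff.1 hi]
  -- With `Δ(t) = Σ bᵢ ⊗ cᵢ`, moving `S(S(bᵢ))` across to the second factor turns the slice into `Σ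
  -- S(bᵢ) cᵢ = S(t₁) t₂ = ε(t) = 1`.
  refine ⟨∑ i ∈ c.support, b.coord i ∘ₗ LinearMap.mulLeft k (antipode k (antipode k (b i))), ?_⟩
  have hsum : ∀ (s : Finset (Module.Basis.ofVectorSpaceIndex k B))
      (g : Module.Basis.ofVectorSpaceIndex k B → Module.Dual k B) (X : B ⊗[k] B),
      slice (∑ i ∈ s, g i) X = ∑ i ∈ s, slice (g i) X := by
    intro s g X
    induction X with
    | zero => simp
    | add x y hx hy => simp only [map_add, hx, hy, Finset.sum_add_distrib]
    | tmul x y => simp [LinearMap.sum_apply, Finset.sum_smul]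
  rw [hsum]
  simp only [← slice_tmul_one_mul, antipode_tmul_one_mul_comul ht, slice_one_tmul_mul, hcoord]
  have h := mul_antipode_rTensor_comul_apply (R := k) t
  rw [← hc, Finsupp.sum] at h
  simpa [h1] using h

variable {q : Module.Dual k B}

/-- Nondegeneracy: `q(S(a) t₁) t₂ = a q(t₁) t₂ = a`, so `a` can be recovered from the functional
`q(S(a) ·)`. -/
theorem slice_comp_mulLeft_antipode
    (ht : ∀ b, b * t = Coalgebra.counit (R := k) b • t)
    (hq : slice q (Coalgebra.comul (R := k) t) = 1) (a : B) :
    slice (q ∘ₗ LinearMap.mulLeft k (antipode k a)) (Coalgebra.comul (R := k) t) = a := by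
  rw [← slice_tmul_one_mul, antipode_tmul_one_mul_comul ht, slice_one_tmul_mul, hq, mul_one]

theorem antipode_injective_of_integral
    (ht : ∀ b, b * t = Coalgebra.counit (R := k) b • t)
    (hq : slice q (Coalgebra.comul (R := k) t) = 1) : Function.Injective (antipode k : B →ₗ[k] B) := by
  intro a b hab
  rw [← slice_comp_mulLeft_antipode ht hq a, hab, slice_comp_mulLeft_antipode ht hq b]

/-- Every `a` equals `q(S(a) t₁) t₂`, so the finitely many right legs of `Δ(t)` span `B`. -/
theorem finite_of_integral
    (ht : ∀ b, b * t = Coalgebra.counit (R := k) b • t)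
    (hq : slice q (Coalgebra.comul (R := k) t) = 1) : Module.Finite k B := by
  classical
  let r := Coalgebra.Repr.arbitrary k t
  refine ⟨⟨r.index.image r.right, ?_⟩⟩
  rw [eq_top_iff]
  intro a _
  rw [← slice_comp_mulLeft_antipode ht hq a, slice_repr _ r]
  refine Submodule.sum_mem _ fun i hi => Submodule.smul_mem _ _ (Submodule.subset_span ?_)
  exact Finset.mem_coe.2 (Finset.mem_image_of_mem _ hi)

theorem antipode_surjective_of_integral
    (ht : ∀ b, b * t = Coalgebra.counit (R := k) b • t)
    (hq : slice q (Coalgebra.comul (R := k) t) = 1) : Function.Surjective (antipode k : B →ₗ[k] B) := by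
  have := finite_of_integral ht hq
  exact LinearMap.injective_iff_surjective.1 (antipode_injective_of_integral ht hq)

/-- The map `F : p ↦ p(t₁) t₂` is onto, hence injective by dimension. It is enough to compare, for
each `p`, the functionals `b ↦ q(b₁) p(b₂)` and `p(1) q` under `F`; both go to `p(1) 1`. -/
theorem slice_comul_eq_smul_one
    (ht : ∀ b, b * t = Coalgebra.counit (R := k) b • t)
    (hq : slice q (Coalgebra.comul (R := k) t) = 1) (b : B) :
    slice q (Coalgebra.comul (R := k) b) = q b • (1 : B) := by
  have := finite_of_integral ht hq
  let F : Module.Dual k B →ₗ[k] B :=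
    { toFun := fun p => slice p (Coalgebra.comul (R := k) t)
      map_add' := fun p p' => by simp [slice, LinearMap.rTensor_add]
      map_smul' := fun c p => by simp [slice, LinearMap.rTensor_smul] }
  have hF : Function.Injective F :=
    (LinearMap.injective_iff_surjective_of_finrank_eq_finrank Subspace.dual_finrank_eq).2
      fun a => ⟨_, slice_comp_mulLeft_antipode ht hq a⟩
  rw [← sub_eq_zero, ← Module.forall_dual_apply_eq_zero_iff k]
  intro p
  have h : F (p ∘ₗ slice q ∘ₗ Coalgebra.comul) = F (p 1 • q) := by
    rw [map_smul]
    change slice _ (Coalgebra.comul (R := k) t) = p 1 • slice q (Coalgebra.comul (R := k) t)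
    rw [hq, slice, LinearMap.rTensor_comp, LinearMap.comp_apply, LinearMap.comp_apply,
      ← comul_slice_comul, hq, Bialgebra.comul_one, Algebra.TensorProduct.one_def]
    simp
  have h' := LinearMap.congr_fun (hF h) b
  simp only [LinearMap.comp_apply, LinearMap.smul_apply, smul_eq_mul] at h'
  rw [map_sub, map_smul, h', smul_eq_mul, mul_comm, sub_self]

end Integral

end HopfAlgebra

/-! ### Integrals in semisimple Hopf algebras -/

/-- A semisimple algebra contains a left eigenvector of weight `χ` for each character `χ`. -/
theorem exists_left_eigenvector_of_isSemisimpleRing {k R : Type*} [Field k] [Ring R] [Algebra k R]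
    [IsSemisimpleRing R] (χ : R →ₐ[k] k) : ∃ e : R, (∀ b, b * e = χ b • e) ∧ χ e = 1 := by
  obtain ⟨J, hJ⟩ := exists_isCompl (RingHom.ker χ)
  obtain ⟨x, hx, y, hy, hxy⟩ := Submodule.mem_sup.1
    (show (1 : R) ∈ RingHom.ker χ ⊔ J by rw [hJ.sup_eq_top]; trivial)
  have hy1 : χ y = 1 := by
    have := congrArg χ hxy
    rwa [map_add, (RingHom.mem_ker).1 hx, zero_add, map_one] at this
  refine ⟨y, fun b => ?_, hy1⟩
  -- The difference lies in the left ideal `J` and in its complement `ker χ`, so it vanishes.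
  have h1 : b * y - χ b • y ∈ J := by
    refine J.sub_mem (J.smul_mem b hy) ?_
    rw [Algebra.smul_def]
    exact J.smul_mem (algebraMap k R (χ b)) hy
  have h2 : b * y - χ b • y ∈ RingHom.ker χ := by
    rw [RingHom.mem_ker, map_sub, map_mul, map_smul, hy1]
    simp
  exact sub_eq_zero.1 ((Submodule.disjoint_def.1 hJ.disjoint) _ h2 h1)

theorem exists_eigenvector_of_isSemisimpleRing {k R : Type*} [Field k] [Ring R] [Algebra k R]
    [IsSemisimpleRing R] (χ : R →ₐ[k] k) :
    ∃ e : R, (∀ b, b * e = χ b • e) ∧ (∀ b, e * b = χ b • e) ∧ χ e = 1 := by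
  obtain ⟨e, he, he1⟩ := exists_left_eigenvector_of_isSemisimpleRing χ
  obtain ⟨f, hf, hf1⟩ := exists_left_eigenvector_of_isSemisimpleRing
    (χ.fromOpposite fun x y => mul_comm _ _)
  have hf' : ∀ b, f.unop * b = χ b • f.unop := fun b =>
    congrArg MulOpposite.unop (hf (MulOpposite.op b))
  -- The left and right eigenvectors agree: their product `f e` equals both `e` and `f`, as `χ` is 1
  -- on each.
  have hfe : f.unop = e := by
    have h1 := he f.unop
    rw [hf' e, he1, show χ f.unop = 1 from hf1, one_smul, one_smul] at h1
    exact h1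
  exact ⟨e, he, hfe ▸ hf', he1⟩

section Adjoint

variable {k H : Type*} [Field k] [Ring H] [HopfAlgebra k H]

theorem sum_counit_mul_counit {ι : Type*} {h : H} (r : Coalgebra.Repr k h ι) :
    ∑ i ∈ r.index, Coalgebra.counit (R := k) (r.left i) * Coalgebra.counit (R := k) (r.right i) =
      Coalgebra.counit (R := k) h := by
  simpa using congrArg (Coalgebra.counit (R := k)) (Coalgebra.sum_counit_smul r)

theorem sum_counit_right_smul {ι : Type*} {h : H} (r : Coalgebra.Repr k h ι) :
    ∑ i ∈ r.index, Coalgebra.counit (R := k) (r.right i) • r.left i = h := by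
  have h := congrArg (TensorProduct.rid k H) (Coalgebra.sum_tmul_counit_eq r)
  simpa only [map_sum, TensorProduct.rid_tmul, one_smul] using h

theorem counit_leftAdjoint (h x : H) : Coalgebra.counit (R := k) (leftAdjoint k h x) =
    Coalgebra.counit (R := k) h * Coalgebra.counit (R := k) x := by
  let r := Coalgebra.Repr.arbitrary k h
  rw [leftAdjoint_apply r, map_sum, ← sum_counit_mul_counit r, Finset.sum_mul]
  exact Finset.sum_congr rfl fun i _ => by simp; ring

theorem counit_rightAdjoint (h x : H) : Coalgebra.counit (R := k) (rightAdjoint k h x) =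
    Coalgebra.counit (R := k) h * Coalgebra.counit (R := k) x := by
  let r := Coalgebra.Repr.arbitrary k h
  rw [rightAdjoint_apply r, map_sum, ← sum_counit_mul_counit r, Finset.sum_mul]
  exact Finset.sum_congr rfl fun i _ => by simp; ring

theorem sum_mul_rightAdjoint {ι : Type*} {h : H} (r : Coalgebra.Repr k h ι) (x : H) :
    ∑ i ∈ r.index, r.left i * rightAdjoint k (r.right i) x = x * h := by
  have hs := sum_mul_mul_eq r LinearMap.id (HopfAlgebra.antipode k) (LinearMap.mulLeft k x)
  simp only [LinearMap.mulLeft_apply, LinearMap.id_apply] at hs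
  simp only [rightAdjoint_apply (Coalgebra.Repr.arbitrary k (r.right _)), mul_assoc,
    Finset.mul_sum]
  rw [hs]
  simp only [← mul_assoc, ← Finset.sum_mul]
  simp only [HopfAlgebra.sum_mul_antipode_eq_smul, smul_mul_assoc, one_mul]
  conv_rhs => rw [← Coalgebra.sum_counit_smul r, Finset.mul_sum]
  simp

end Adjoint

/-! ### Centrality of the integral of a normal Hopf subalgebra -/

namespace HopfSubalgebra

variable {k H : Type*} [Field k] [Ring H] [HopfAlgebra k H] {A : HopfSubalgebra k H}

theorem exists_integral (A : HopfSubalgebra k H) [IsSemisimpleRing A.toSubalgebra] :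
    ∃ e : A.toSubalgebra, (∀ b, b * e = Coalgebra.counit (R := k) b • e) ∧
      (∀ b, e * b = Coalgebra.counit (R := k) b • e) ∧ Coalgebra.counit (R := k) e = 1 :=
  exists_eigenvector_of_isSemisimpleRing (Bialgebra.counitAlgHom k A.toSubalgebra)

/-- Write `a h = h₁ (S(h₂) a h₃)`; the bracket lies in `A` by normality, so it acts on `e` through
the counit. -/
theorem IsNormal.mul_mul_integral (hA : A.IsNormal) {e : A.toSubalgebra}
    (he : ∀ b, b * e = Coalgebra.counit (R := k) b • e) (a : A.toSubalgebra) (h : H) :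
    (a : H) * h * (e : H) = Coalgebra.counit (R := k) a • (h * (e : H)) := by
  let r := Coalgebra.Repr.arbitrary k h
  have key : ∀ g : H, rightAdjoint k g (a : H) * (e : H) =
      (Coalgebra.counit (R := k) g * Coalgebra.counit (R := k) a) • (e : H) := by
    intro g
    rw [counit_coe, ← counit_rightAdjoint]
    exact congrArg Subtype.val (he ⟨_, (hA g a a.2).2⟩)
  rw [← sum_mul_rightAdjoint r, Finset.sum_mul]
  simp only [mul_assoc, key]
  conv_rhs => rw [← sum_counit_right_smul r, Finset.sum_mul, Finset.smul_sum]
  refine Finset.sum_congr rfl fun i _ => ?_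
  rw [mul_smul_comm, smul_mul_assoc, smul_smul, mul_comm]

/-- Let `x = h₁ e S(h₂)`, an element of `A`. Then `e x = x` by `mul_mul_integral`, while `e x = ε(x)
e` since `e` is also a right integral. -/
theorem IsNormal.leftAdjoint_integral (hA : A.IsNormal) {e : A.toSubalgebra}
    (he : ∀ b, b * e = Coalgebra.counit (R := k) b • e)
    (he' : ∀ b, e * b = Coalgebra.counit (R := k) b • e) (h1 : Coalgebra.counit (R := k) e = 1)
    (h : H) : leftAdjoint k h (e : H) = Coalgebra.counit (R := k) h • (e : H) := by
  let r := Coalgebra.Repr.arbitrary k h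
  have h2 : (e : H) * leftAdjoint k h (e : H) = leftAdjoint k h (e : H) := by
    rw [leftAdjoint_apply r, Finset.mul_sum]
    refine Finset.sum_congr rfl fun i _ => ?_
    rw [← mul_assoc, ← mul_assoc, hA.mul_mul_integral he, h1, one_smul]
  have h3 : (e : H) * leftAdjoint k h (e : H) =
      Coalgebra.counit (R := k) (leftAdjoint k h (e : H)) • (e : H) :=
    congrArg Subtype.val (he' ⟨_, (hA h e e.2).1⟩)
  rw [← h2, h3, counit_leftAdjoint, ← counit_coe, h1, mul_one]

theorem IsNormal.commute_integral (hA : A.IsNormal) {e : A.toSubalgebra}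
    (he : ∀ b, b * e = Coalgebra.counit (R := k) b • e)
    (he' : ∀ b, e * b = Coalgebra.counit (R := k) b • e) (h1 : Coalgebra.counit (R := k) e = 1)
    (h : H) : h * (e : H) = (e : H) * h := by
  let r := Coalgebra.Repr.arbitrary k h
  rw [← sum_leftAdjoint_mul r]
  simp only [hA.leftAdjoint_integral he he' h1, smul_mul_assoc]
  conv_rhs => rw [← Coalgebra.sum_counit_smul r, Finset.mul_sum]
  simp

end HopfSubalgebra

/-! ### The multiplication map `A # L → H` -/

namespace HopfSubalgebra

variable {k H : Type*} [Field k] [Ring H] [HopfAlgebra k H] (A L : HopfSubalgebra k H)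
  (hA : A.IsNormal)

/-- The linear map `a # l ↦ a l`. -/
def smashMulLinear : SmashProduct (A.adjointAction L hA) →ₗ[k] H :=
  LinearMap.mul' k H ∘ₗ TensorProduct.map A.incl L.incl

theorem smashMulLinear_mk (a : A.toSubalgebra) (l : L.toSubalgebra) :
    smashMulLinear A L hA (SmashProduct.mk _ a l) = (a : H) * (l : H) := rfl

theorem smashMulLinear_mul (x y : SmashProduct (A.adjointAction L hA)) :
    smashMulLinear A L hA (x * y) = smashMulLinear A L hA x * smashMulLinear A L hA y := by
  induction x using SmashProduct.induction with
  | h0 => simp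
  | hadd x x' hx hx' => simp only [map_add, add_mul, hx, hx']
  | hmk a l =>
    induction y using SmashProduct.induction with
    | h0 => simp
    | hadd y y' hy hy' => simp only [map_add, mul_add, hy, hy']
    | hmk b h =>
      let r := Coalgebra.Repr.arbitrary k l
      rw [SmashProduct.mk_mul_mk _ r, map_sum]
      simp only [smashMulLinear_mk, Subalgebra.coe_mul, coe_adjointAction_act]
      have := sum_leftAdjoint_mul (L.reprCoe r) (b : H)
      calc _ = (a : H) * (∑ i ∈ r.index, leftAdjoint k (r.left i : H) (b : H) *
              (r.right i : H)) * (h : H) := by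
            simp only [Finset.mul_sum, Finset.sum_mul, mul_assoc]
        _ = (a : H) * ((l : H) * (b : H)) * (h : H) := by rw [← this]; rfl
        _ = _ := by simp only [mul_assoc]

/-- The multiplication map `a # l ↦ a l`, as an algebra map to `H`. -/
def smashMul : SmashProduct (A.adjointAction L hA) →ₐ[k] H :=
  AlgHom.ofLinearMap (smashMulLinear A L hA)
    (by rw [SmashProduct.one_def, smashMulLinear_mk]; simp) (smashMulLinear_mul A L hA)

theorem smashMul_mk (a : A.toSubalgebra) (l : L.toSubalgebra) :
    smashMul A L hA (SmashProduct.mk _ a l) = (a : H) * (l : H) := rfl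

theorem map_smashMul_comul (x : SmashProduct (A.adjointAction L hA)) :
    TensorProduct.map (smashMul A L hA).toLinearMap (smashMul A L hA).toLinearMap
      (Coalgebra.comul (R := k) x) = Coalgebra.comul (R := k) (smashMul A L hA x) := by
  induction x using SmashProduct.induction with
  | h0 => simp
  | hadd x y hx hy => simp only [map_add, hx, hy]
  | hmk a l =>
    let r := Coalgebra.Repr.arbitrary k a
    let s := Coalgebra.Repr.arbitrary k l
    rw [SmashProduct.comul_mk _ r s, smashMul_mk, Bialgebra.comul_mul, ← (A.reprCoe r).eq,
      ← (L.reprCoe s).eq, Finset.sum_mul_sum]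
    simp only [map_sum, TensorProduct.map_tmul, AlgHom.toLinearMap_apply, smashMul_mk,
      Algebra.TensorProduct.tmul_mul_tmul]
    rfl

theorem counit_smashMul (x : SmashProduct (A.adjointAction L hA)) :
    Coalgebra.counit (R := k) (smashMul A L hA x) = Coalgebra.counit (R := k) x := by
  induction x using SmashProduct.induction with
  | h0 => simp
  | hadd x y hx hy => simp only [map_add, hx, hy]
  | hmk a l => rw [smashMul_mk, SmashProduct.counit_mk, Bialgebra.counit_mul]; rfl

/-- The formula for the antipode of `A # L` mirrors `S(a l) = S(l) S(a)`. -/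
theorem smashMul_antipode (x : SmashProduct (A.adjointAction L hA)) :
    smashMul A L hA (SmashProduct.antipode _ x) =
      HopfAlgebra.antipode k (smashMul A L hA x) := by
  induction x using SmashProduct.induction with
  | h0 => simp
  | hadd x y hx hy => simp only [map_add, hx, hy]
  | hmk a l =>
    rw [SmashProduct.antipode_mk, map_mul, smashMul_mk, smashMul_mk, smashMul_mk,
      HopfAlgebra.antipode_mul_antidistrib]
    simp only [OneMemClass.coe_one, mul_one, one_mul]
    rfl

/-- The Hopf subalgebra `A L` of `H`. -/
def smashRange : HopfSubalgebra k H where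
  toSubalgebra := (smashMul A L hA).range
  comul_mem' := by
    rintro _ ⟨x, rfl⟩
    have h : (smashMul A L hA).toLinearMap = (smashMul A L hA).range.val.toLinearMap ∘ₗ
      (smashMul A L hA).rangeRestrict.toLinearMap := rfl
    have hx := map_smashMul_comul A L hA x
    rw [h, TensorProduct.map_comp] at hx
    exact ⟨_, hx⟩
  antipode_mem' := by
    rintro _ ⟨x, rfl⟩
    exact ⟨_, smashMul_antipode A L hA x⟩

theorem toSubmodule_smashRange :
    Subalgebra.toSubmodule (smashRange A L hA).toSubalgebra =
      Subalgebra.toSubmodule A.toSubalgebra * Subalgebra.toSubmodule L.toSubalgebra := by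
  apply le_antisymm
  · rintro _ ⟨x, rfl⟩
    induction x using SmashProduct.induction with
    | h0 => rw [map_zero]; exact zero_mem _
    | hadd x y hx hy => rw [map_add]; exact add_mem hx hy
    | hmk a l => exact Submodule.mul_mem_mul a.2 l.2
  · rw [Submodule.mul_le]
    intro a ha l hl
    exact ⟨SmashProduct.mk _ ⟨a, ha⟩ ⟨l, hl⟩, rfl⟩

theorem mul_mem_smashRange (a : A.toSubalgebra) (l : L.toSubalgebra) :
    (a : H) * (l : H) ∈ (smashRange A L hA).toSubalgebra :=
  ⟨SmashProduct.mk _ a l, rfl⟩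

end HopfSubalgebra

/-! ### Injectivity of the multiplication map -/

namespace HopfSubalgebra

open HopfAlgebra (slice slice_tmul slice_repr slice_one_tmul_mul slice_tmul_one_mul)

variable {k H : Type*} [Field k] [Ring H] [HopfAlgebra k H] {A L : HopfSubalgebra k H}

theorem slice_comul_coe (P : HopfSubalgebra k H) (q : Module.Dual k H) (p : P.toSubalgebra) :
    slice q (Coalgebra.comul (R := k) (p : H)) =
      (slice (q ∘ₗ P.incl) (Coalgebra.comul (R := k) p) : P.toSubalgebra) := by
  let r := Coalgebra.Repr.arbitrary k p
  rw [slice_repr _ r, slice_repr q (P.reprCoe r), AddSubmonoidClass.coe_finsetSum]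
  rfl

theorem slice_comul_mem (P : HopfSubalgebra k H) (q : Module.Dual k H) {p : H}
    (hp : p ∈ P.toSubalgebra) : slice q (Coalgebra.comul (R := k) p) ∈ P.toSubalgebra := by
  rw [P.slice_comul_coe q ⟨p, hp⟩]
  exact Subtype.property _

/-- A Hopf subalgebra with a normalized left integral `t` carries a dual integral, which extends
to a functional on the ambient Hopf algebra. -/
theorem exists_dual_integral (P : HopfSubalgebra k H) {t : P.toSubalgebra}
    (ht : ∀ b, b * t = Coalgebra.counit (R := k) b • t) (h1 : Coalgebra.counit (R := k) t = 1) :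
    ∃ q : Module.Dual k H, q t = 1 ∧
      ∀ p ∈ P.toSubalgebra, slice q (Coalgebra.comul (R := k) p) = q p • (1 : H) := by
  obtain ⟨q, hq⟩ := HopfAlgebra.exists_slice_comul_eq_one ht h1
  obtain ⟨g, hg⟩ := P.incl.exists_leftInverse_of_injective (LinearMap.ker_eq_bot.2 P.incl_injective)
  have hqg : (q ∘ₗ g) ∘ₗ P.incl = q := by rw [LinearMap.comp_assoc, hg, LinearMap.comp_id]
  have hqg' : ∀ p : P.toSubalgebra, (q ∘ₗ g) (p : H) = q p := LinearMap.congr_fun hqg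
  refine ⟨q ∘ₗ g, ?_, fun p hp => ?_⟩
  -- The normalization is automatic: `q(t) 1 = q(t₁) t₂ = 1`, and the counit extracts `q(t)`.
  · have h := HopfAlgebra.slice_comul_eq_smul_one ht hq t
    rw [hq] at h
    have := congrArg (Coalgebra.counit (R := k)) h
    rw [hqg']
    simpa using this.symm
  · rw [P.slice_comul_coe _ ⟨p, hp⟩, hqg, HopfAlgebra.slice_comul_eq_smul_one ht hq,
      hqg' ⟨p, hp⟩]
    rfl

theorem one_tmul_integral_mul_comul {e : A.toSubalgebra}
    (he' : ∀ b, e * b = Coalgebra.counit (R := k) b • e) (a : A.toSubalgebra) :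
    ((1 : H) ⊗ₜ[k] (e : H)) * Coalgebra.comul (R := k) (a : H) = (a : H) ⊗ₜ[k] (e : H) := by
  let r := Coalgebra.Repr.arbitrary k a
  have he : ∀ b : A.toSubalgebra, (e : H) * (b : H) = Coalgebra.counit (R := k) (b : H) • (e : H) :=
    fun b => congrArg Subtype.val (he' b)
  rw [← (A.reprCoe r).eq, Finset.mul_sum]
  conv_rhs => rw [← sum_counit_right_smul (A.reprCoe r), TensorProduct.sum_tmul]
  refine Finset.sum_congr rfl fun i _ => ?_
  rw [Algebra.TensorProduct.tmul_mul_tmul, one_mul, TensorProduct.smul_tmul]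
  exact congrArg _ (he _)

/-- Elements coinvariant modulo the integral of a normal Hopf subalgebra `A` belong to `A`. -/
theorem mem_of_coinvariant {e : A.toSubalgebra}
    (he : ∀ b, b * e = Coalgebra.counit (R := k) b • e) (h1 : Coalgebra.counit (R := k) e = 1)
    (hc : ∀ h : H, h * (e : H) = (e : H) * h) {x : H}
    (hx : ((e : H) ⊗ₜ[k] (1 : H)) * Coalgebra.comul (R := k) x = (e : H) ⊗ₜ[k] x) :
    x ∈ A.toSubalgebra := by
  obtain ⟨q, hq1, hq⟩ := A.exists_dual_integral he h1
  have hslice : ∀ (p : Module.Dual k H) (X : H ⊗[k] H),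
      slice p ((HopfAlgebra.antipode k).lTensor H X) = HopfAlgebra.antipode k (slice p X) := by
    intro p X
    induction X with
    | zero => simp
    | add x y hx hy => simp only [map_add, hx, hy]
    | tmul x y => simp
  have hmul : ∀ (X : H ⊗[k] H), slice q (X * (1 ⊗ₜ[k] x)) = slice q X * x := by
    intro X
    induction X with
    | zero => simp
    | add x y hx hy => simp only [map_add, add_mul, hx, hy]
    | tmul x y => simp
  let r := Coalgebra.Repr.arbitrary k x
  -- Apply `u ⊗ v ↦ u₁ ⊗ S(u₂) v` to the coinvariance equation: it becomes `x e₁ ⊗ S(e₂) = e₁ ⊗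
  -- S(e₂) x`. Slicing by `q` leaves `x` on the right and, on the left, the antipode of an element
  -- of `A`.
  let G : H ⊗[k] H →ₗ[k] H ⊗[k] H := TensorProduct.lift
    ((LinearMap.mul k (H ⊗[k] H)).compl₁₂ ((HopfAlgebra.antipode k).lTensor H ∘ₗ Coalgebra.comul)
      (TensorProduct.mk k H H 1))
  have hG : ∀ u v : H, G (u ⊗ₜ[k] v) =
    (HopfAlgebra.antipode k).lTensor H (Coalgebra.comul (R := k) u) * (1 ⊗ₜ[k] v) :=
      fun u v => rfl
  have hkey := HopfAlgebra.sum_lTensor_antipode_comul_mul r (Coalgebra.comul (R := k) (e : H))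
  have hx' := congrArg G hx
  rw [← r.eq, Finset.mul_sum, map_sum] at hx'
  simp only [Algebra.TensorProduct.tmul_mul_tmul, one_mul, ← hc, hG, Bialgebra.comul_mul] at hx'
  rw [hkey] at hx'
  have h := congrArg (slice q) hx'
  rw [hmul, hslice, hq _ e.2, hq1, one_smul, HopfAlgebra.antipode_one, one_mul,
    slice_tmul_one_mul, hslice] at h
  rw [← h]
  exact A.antipode_mem' _ (A.slice_comul_mem _ e.2)

theorem mul_integral_smashRange (hA : A.IsNormal) {e : A.toSubalgebra}
    (he : ∀ b, b * e = Coalgebra.counit (R := k) b • e)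
    (hc : ∀ h : H, h * (e : H) = (e : H) * h) {f : L.toSubalgebra}
    (hf : ∀ b, b * f = Coalgebra.counit (R := k) b • f) (b : (smashRange A L hA).toSubalgebra) :
    b * ⟨(e : H) * (f : H), mul_mem_smashRange A L hA e f⟩ =
      Coalgebra.counit (R := k) b • ⟨(e : H) * (f : H), mul_mem_smashRange A L hA e f⟩ := by
  obtain ⟨_, x, rfl⟩ := b
  apply Subtype.ext
  change smashMul A L hA x * ((e : H) * (f : H)) =
    Coalgebra.counit (R := k) (smashMul A L hA x) • ((e : H) * (f : H))
  induction x using SmashProduct.induction with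
  | h0 => simp
  | hadd x y hx hy => simp only [map_add, add_mul, add_smul, hx, hy]
  | hmk a l =>
    have ha : (a : H) * (e : H) = Coalgebra.counit (R := k) (a : H) • (e : H) :=
      congrArg Subtype.val (he a)
    have hl : (l : H) * (f : H) = Coalgebra.counit (R := k) (l : H) • (f : H) :=
      congrArg Subtype.val (hf l)
    calc (a : H) * (l : H) * ((e : H) * (f : H)) = (a : H) * ((l : H) * (e : H)) * (f : H) := by
          simp only [mul_assoc]
      _ = ((a : H) * (e : H)) * ((l : H) * (f : H)) := by rw [hc]; simp only [mul_assoc]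
      _ = _ := by rw [ha, hl, smashMul_mk, Bialgebra.counit_mul, smul_mul_smul_comm]

/-- If `A ∩ L = k`, multiplication by the integral of `A` is injective on `L`. -/
theorem eq_zero_of_integral_mul_eq_zero (hAL : A.toSubalgebra ⊓ L.toSubalgebra = ⊥)
    (hA : A.IsNormal) {e : A.toSubalgebra}
    (he : ∀ b, b * e = Coalgebra.counit (R := k) b • e)
    (he' : ∀ b, e * b = Coalgebra.counit (R := k) b • e) (h1 : Coalgebra.counit (R := k) e = 1)
    {f : L.toSubalgebra} (hf : ∀ b, b * f = Coalgebra.counit (R := k) b • f)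
    (hf1 : Coalgebra.counit (R := k) f = 1) (l : L.toSubalgebra) (hl : (e : H) * (l : H) = 0) :
    l = 0 := by
  have hc := hA.commute_integral he he' h1
  obtain ⟨q, hq1, hq⟩ := (smashRange A L hA).exists_dual_integral
    (mul_integral_smashRange hA he hc hf) (by
      rw [counit_coe, Bialgebra.counit_mul, ← counit_coe, ← counit_coe, h1, hf1, one_mul])
  let m : Module.Dual k H := q ∘ₗ LinearMap.mulLeft k (e : H)
  -- Invariance of `q` at `e g`, multiplied by `e`: `(1 ⊗ e) Δ(e g) = e g₁ ⊗ e g₂`.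
  have hm : ∀ g : L.toSubalgebra,
      (e : H) * slice m (Coalgebra.comul (R := k) (g : H)) = m (g : H) • (e : H) := by
    intro g
    have h := congrArg ((e : H) * ·) (hq _ (mul_mem_smashRange A L hA e g))
    simp only [mul_smul_comm, mul_one] at h
    rw [← slice_one_tmul_mul, Bialgebra.comul_mul, ← mul_assoc, one_tmul_integral_mul_comul he',
      show (e : H) ⊗ₜ[k] (e : H) = ((e : H) ⊗ₜ[k] (1 : H)) * ((1 : H) ⊗ₜ[k] (e : H)) by simp,
      mul_assoc, slice_tmul_one_mul, slice_one_tmul_mul] at h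
    exact h
  have hm1 : ∀ g : L.toSubalgebra,
      slice m (Coalgebra.comul (R := k) (g : H)) = m (g : H) • (1 : H) := by
    intro g
    have hxA : slice m (Coalgebra.comul (R := k) (g : H)) ∈ A.toSubalgebra := by
      apply mem_of_coinvariant he h1 hc
      let r := L.reprCoe (Coalgebra.Repr.arbitrary k g)
      rw [HopfAlgebra.comul_slice_comul, ← r.eq, map_sum, map_sum, Finset.mul_sum,
        TensorProduct.tmul_sum]
      refine Finset.sum_congr rfl fun i _ => ?_
      rw [LinearMap.rTensor_tmul, Algebra.TensorProduct.tmul_mul_tmul, one_mul, slice_tmul,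
        ← TensorProduct.smul_tmul]
      exact congrArg (· ⊗ₜ[k] _) (hm _)
    have hx : slice m (Coalgebra.comul (R := k) (g : H)) ∈ (⊥ : Subalgebra k H) :=
      hAL ▸ ⟨hxA, L.slice_comul_mem m g.2⟩
    -- The scalar is identified as `m(g)` by applying `ε` to `hm g`, using `ε(e) = 1`.
    obtain ⟨c, hc⟩ := Algebra.mem_bot.1 hx
    have h := congrArg (Coalgebra.counit (R := k)) (hm g)
    have hε : Coalgebra.counit (R := k) (e : H) = 1 := h1
    rw [← hc, Algebra.algebraMap_eq_smul_one, mul_smul_comm, mul_one, map_smul, map_smul, hε,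
      smul_eq_mul, smul_eq_mul, mul_one, mul_one] at h
    rw [← hc, h, Algebra.algebraMap_eq_smul_one]
  have hmf : slice (m ∘ₗ L.incl) (Coalgebra.comul (R := k) f) = 1 := by
    apply Subtype.ext
    rw [← L.slice_comul_coe, hm1]
    change q ((e : H) * (f : H)) • (1 : H) = 1
    rw [hq1, one_smul]
  -- With `l = S(d)`, nondegeneracy gives `d = m(l f₁) f₂ = q(e l f₁) f₂`, which is zero because `e
  -- l = 0`.
  obtain ⟨d, rfl⟩ := HopfAlgebra.antipode_surjective_of_integral hf hmf l
  have hd := HopfAlgebra.slice_comp_mulLeft_antipode hf hmf d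
  have h0 : (m ∘ₗ L.incl) ∘ₗ LinearMap.mulLeft k (HopfAlgebra.antipode k d) = 0 := by
    ext b
    change q ((e : H) * ((HopfAlgebra.antipode k d : L.toSubalgebra) * (b : H))) = 0
    rw [← mul_assoc, hl, zero_mul, map_zero]
  rw [h0] at hd
  rw [← hd]
  simp [slice]

theorem smashMul_injective [IsSemisimpleRing A.toSubalgebra] [IsSemisimpleRing L.toSubalgebra]
    (hAL : A.toSubalgebra ⊓ L.toSubalgebra = ⊥) (hA : A.IsNormal) :
    Function.Injective (smashMul A L hA) := by
  obtain ⟨e, he, he', h1⟩ := A.exists_integral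
  obtain ⟨f, hf, -, hf1⟩ := L.exists_integral
  obtain ⟨g, hg⟩ := (LinearMap.mulLeft k (e : H) ∘ₗ L.incl).exists_leftInverse_of_injective
    (LinearMap.ker_eq_bot'.2
      (eq_zero_of_integral_mul_eq_zero hAL hA he he' h1 hf hf1))
  have hg' : ∀ l : L.toSubalgebra, g ((e : H) * (l : H)) = l := LinearMap.congr_fun hg
  -- `U` is `x ⊗ y ↦ x S(y₁) ⊗ y₂`, which undoes `a ⊗ l ↦ a l₁ ⊗ l₂`. In `T`, the map `g` first
  -- cancels `e` from the second factor.
  let U : H ⊗[k] H →ₗ[k] H ⊗[k] H := (LinearMap.mul' k H).rTensor H ∘ₗ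
    (TensorProduct.assoc k H H H).symm.toLinearMap ∘ₗ
      ((HopfAlgebra.antipode k).rTensor H ∘ₗ Coalgebra.comul).lTensor H
  let T : H →ₗ[k] H ⊗[k] H := U ∘ₗ (L.incl ∘ₗ g).lTensor H ∘ₗ
    LinearMap.mulLeft k ((1 : H) ⊗ₜ[k] (e : H)) ∘ₗ Coalgebra.comul
  have hU : ∀ (a : H) {l : H} {ι : Type _} (r : Coalgebra.Repr k l ι),
      ∑ i ∈ r.index, U ((a * r.left i) ⊗ₜ[k] r.right i) = a ⊗ₜ[k] l := by
    intro a l ι r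
    have h := congrArg (TensorProduct.map (LinearMap.mulLeft k a ∘ₗ LinearMap.mul' k H ∘ₗ
        (HopfAlgebra.antipode k).lTensor H) LinearMap.id ∘ₗ
        (TensorProduct.assoc k H H H).symm.toLinearMap)
      (Coalgebra.sum_tmul_tmul_eq r (fun i => Coalgebra.Repr.arbitrary k (r.left i))
      (fun i => Coalgebra.Repr.arbitrary k (r.right i)))
    simp only [map_sum, LinearMap.comp_apply, LinearMap.lTensor_tmul, LinearEquiv.coe_coe,
      TensorProduct.assoc_symm_tmul, TensorProduct.map_tmul, LinearMap.mul'_apply,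
      LinearMap.mulLeft_apply, LinearMap.id_apply, ← TensorProduct.sum_tmul, ← Finset.mul_sum,
      HopfAlgebra.sum_mul_antipode_eq_smul, mul_smul_comm, mul_one, TensorProduct.smul_tmul] at h
    rw [← TensorProduct.tmul_sum, Coalgebra.sum_counit_smul] at h
    rw [h]
    refine Finset.sum_congr rfl fun i _ => ?_
    simp only [U, LinearMap.comp_apply, LinearMap.lTensor_tmul]
    rw [← (Coalgebra.Repr.arbitrary k (r.right i)).eq]
    simp [TensorProduct.tmul_sum, mul_assoc]
  have hT : ∀ x : SmashProduct (A.adjointAction L hA),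
      T (smashMul A L hA x) = TensorProduct.map A.incl L.incl x := by
    intro x
    induction x using SmashProduct.induction with
    | h0 => rw [map_zero, map_zero]; exact (map_zero (TensorProduct.map A.incl L.incl)).symm
    | hadd x y hx hy =>
      rw [map_add, map_add, hx, hy]; exact (map_add (TensorProduct.map A.incl L.incl) x y).symm
    | hmk a l =>
      let r := Coalgebra.Repr.arbitrary k l
      change _ = (a : H) ⊗ₜ[k] (l : H)
      rw [← hU (a : H) (L.reprCoe r)]
      simp only [T, LinearMap.comp_apply, LinearMap.mulLeft_apply, smashMul_mk]
      rw [Bialgebra.comul_mul, ← mul_assoc, one_tmul_integral_mul_comul he', ← (L.reprCoe r).eq,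
        Finset.mul_sum, map_sum, map_sum]
      refine Finset.sum_congr rfl fun i _ => ?_
      rw [Algebra.TensorProduct.tmul_mul_tmul, LinearMap.lTensor_tmul, LinearMap.comp_apply]
      exact congrArg (fun y : L.toSubalgebra => U (_ ⊗ₜ[k] (y : H))) (hg' _)
  intro x y hxy
  apply TensorProduct.map_injective_of_flat_flat A.incl L.incl A.incl_injective L.incl_injective
  rw [← hT, ← hT, hxy]

/-! ### Transport of the Hopf structure along the injective multiplication map -/

theorem isHopfAlgebra_smashProduct {hA : A.IsNormal}
    (hinj : Function.Injective (smashMul A L hA)) :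
    IsHopfAlgebra k (SmashProduct.antipode (A.adjointAction L hA)) := by
  let C := hopfAlgebraOfInjective (smashMul A L hA) hinj Coalgebra.comul
    (map_smashMul_comul A L hA) (SmashProduct.antipode _) (smashMul_antipode A L hA)
  -- The transported structure has the same comultiplication by construction, but its counit is `ε`
  -- composed with multiplication, to be matched with the tensor product counit.
  have hcounit : (Coalgebra.counit : SmashProduct (A.adjointAction L hA) →ₗ[k] k) =
      C.toCoalgebra.counit :=
    LinearMap.ext fun x => (counit_smashMul A L hA x).symm
  exact
    { counit_one := by rw [hcounit]; exact C.counit_one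
      counit_mul := fun x y => by
        rw [hcounit]
        exact @Bialgebra.counit_mul k _ _ _ C.toBialgebra x y
      comul_one := C.comul_one
      comul_mul := fun x y => @Bialgebra.comul_mul k _ _ _ C.toBialgebra x y
      mul_antipode_rTensor_comul := by rw [hcounit]; exact C.mul_antipode_rTensor_comul
      mul_antipode_lTensor_comul := by rw [hcounit]; exact C.mul_antipode_lTensor_comul }

/-- For `A ∩ L = k`, multiplication is an isomorphism from `A # L` to `A L`. -/
def smashEquiv {hA : A.IsNormal} (hinj : Function.Injective (smashMul A L hA)) :
    SmashProduct (A.adjointAction L hA) ≃ₐc[k] (smashRange A L hA).toSubalgebra where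
  __ := AlgEquiv.ofInjective (smashMul A L hA) hinj
  map_smul' := map_smul (AlgEquiv.ofInjective (smashMul A L hA) hinj)
  counit_comp := LinearMap.ext (counit_smashMul A L hA)
  map_comp_comul := by
    ext x
    apply (smashRange A L hA).map_incl_injective
    have hx := (map_smashMul_comul A L hA x).trans
      ((smashRange A L hA).map_incl_comul
        (AlgEquiv.ofInjective (smashMul A L hA) hinj x)).symm
    refine Eq.trans ?_ hx
    simp only [LinearMap.comp_apply]
    rw [← LinearMap.comp_apply, ← TensorProduct.map_comp]
    rfl

end HopfSubalgebra

end

theorem corollary3p4 {k H : Type*} [Field k] [IsAlgClosed k] [CharZero k]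
    [Ring H] [HopfAlgebra k H] (A L : HopfSubalgebra k H)
    [IsSemisimpleRing A.toSubalgebra] [IsSemisimpleRing L.toSubalgebra]
    (hAL : A.toSubalgebra ⊓ L.toSubalgebra = ⊥) (hA : A.IsNormal) :
    ∃ P : HopfSubalgebra k H,
      Subalgebra.toSubmodule P.toSubalgebra =
        Subalgebra.toSubmodule A.toSubalgebra * Subalgebra.toSubmodule L.toSubalgebra ∧
      IsHopfAlgebra k (SmashProduct.antipode (A.adjointAction L hA)) ∧
      ∃ φ : SmashProduct (A.adjointAction L hA) ≃ₐc[k] P.toSubalgebra,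
        (∀ (a : A.toSubalgebra) (l : L.toSubalgebra),
          (φ (SmashProduct.mk (A.adjointAction L hA) a l) : H) = (a : H) * (l : H)) ∧
        ∀ x, φ (SmashProduct.antipode (A.adjointAction L hA) x) =
          HopfAlgebra.antipode k (φ x) := by

  have hinj := HopfSubalgebra.smashMul_injective hAL hA
  exact ⟨HopfSubalgebra.smashRange A L hA, HopfSubalgebra.toSubmodule_smashRange A L hA,
    HopfSubalgebra.isHopfAlgebra_smashProduct hinj, HopfSubalgebra.smashEquiv hinj,
    fun _ _ => rfl, fun x => Subtype.ext (HopfSubalgebra.smashMul_antipode A L hA x)⟩
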